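/- Let $G=(V,E)$ be a finite, nonempty, undirected loopless graph without multiple edges. For $v\in V$ let $N(v)$ be the set of vertices adjacent to $v$, and let $\mathcal N=\{N(v): v\in V\}$, a nonempty family of subsets of $V$ (the neighbourhood-set system of $G$). The one-inclusion graph of $\mathcal N$ has the members of $\mathcal N$ as vertices, with an edge between $A$ and $B$ whenever $B=A\cup\{b\}$ for some $b\in V\setminus A$ or $A=B\cup\{a\}$ for some $a\in V\setminus B$. The family $\mathcal N$ is called well-graded if for all $A,B\in\mathcal N$ the distance between $A$ and $B$ in the one-inclusion graph equals $|A\mathbin{\triangle}B|$ (the distance being $\infty$ if no path joins them). A half-graph of order $n\ge 1$ is a bipartite graph with parts $\{a_1,\dots,a_n\}$ and $\{b_1,\dots,b_n\}$, consisting of $2n$ distinct vertices, such that either for all $i,j$ we have $a_i\sim b_j$ if and only if $i\le j$, or for all $i,j$ we have $a_i\sim b_j$ if and only if $i\ge j$. Then the neighbourhood-set system $\mathcal N$ of $G$ is well-graded if and only if one of the following holds: 1. every vertex of $G$ is isolated (so $G$ is a nonempty set of isolated vertices); 2. $G$ is the disjoint union of one or more half-graphs (possibly of different orders) and a nonempty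 set of isolated vertices, with no edges between different parts of the union. -/

import Mathlib

universe u

/-- A set system on the domain `X`: a nonempty family of subsets of `X`. -/
structure SetSystem (X : Type u) where
  /-- The members of the system. -/
  family : Set (Set X)
  /-- The family is nonempty. -/
  nonempty : family.Nonempty

namespace SetSystem

variable {X : Type u}

/-- The (directed) one-inclusion graph: its vertices are the members of the system, and there is an
edge from `A` to `B` exactly when `B = A ∪ {b}` for some point `b` outside `A`. -/
def oneInclusionDigraph (F : SetSystem X) : Digraph F.family where
  Adj A B := ∃ b : X, b ∉ (A : Set X) ∧ (B : Set X) = (A : Set X) ∪ {b}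

/-- The underlying undirected graph of the one-inclusion graph. -/
def oneInclusionGraph (F : SetSystem X) : SimpleGraph F.family :=
  F.oneInclusionDigraph.toSimpleGraphInclusive

/-- A set system is well-graded if the Hamming distance `|A ∆ B|` of any two members is their
distance in the one-inclusion graph. The graph distance is `ℕ∞`-valued, with value `⊤` for vertices
in different connected components. -/
def IsWellGraded (F : SetSystem X) : Prop :=
  ∀ A B : F.family,
    (symmDiff (A : Set X) (B : Set X)).encard = F.oneInclusionGraph.edist A B

end SetSystem

namespace SimpleGraph

variable {V : Type u}

/-- The neighbourhood-set system of a graph: the family of the neighbourhoods of all vertices. -/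
def neighbourhoodSystem [Nonempty V] (G : SimpleGraph V) : SetSystem V where
  family := Set.range G.neighborSet
  nonempty := Set.range_nonempty G.neighborSet

/-- A graph is neighbourhood-well-graded if its neighbourhood-set system is well-graded. -/
def IsNeighbourhoodWellGraded [Nonempty V] (G : SimpleGraph V) : Prop :=
  G.neighbourhoodSystem.IsWellGraded

/-- The bipartite graph with parts `a i = Sum.inl i` and `b j = Sum.inr j`, where `i` and `j` run
over `Fin n`, in which `a i` and `b j` are adjacent exactly when `r i j`. -/
def bipartiteOfRel (n : ℕ) (r : Fin n → Fin n → Prop) : SimpleGraph (Fin n ⊕ Fin n) where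
  Adj
    | Sum.inl i, Sum.inr j => r i j
    | Sum.inr j, Sum.inl i => r i j
    | _, _ => False
  symm := ⟨by
    rintro (i | i) (j | j) h
    · exact h
    · exact h
    · exact h
    · exact h⟩
  loopless := ⟨by
    rintro (i | i) h
    · exact h
    · exact h⟩

/-- A graph is a half-graph of order `n ≥ 1` if it is isomorphic to the bipartite graph with parts
`a 1, …, a n` and `b 1, …, b n` in which `a i ∼ b j` iff `i ≤ j`, or to the one in which
`a i ∼ b j` iff `i ≥ j`. -/
def IsHalfGraph {W : Type u} (H : SimpleGraph W) : Prop :=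
  ∃ n : ℕ, 1 ≤ n ∧
    (Nonempty (H ≃g bipartiteOfRel n (fun i j => i ≤ j)) ∨
      Nonempty (H ≃g bipartiteOfRel n (fun i j => i ≥ j)))

/-- The graph is a nonempty set of isolated vertices. -/
def IsNonemptySetOfIsolatedVertices (G : SimpleGraph V) : Prop :=
  Nonempty V ∧ ∀ v : V, G.IsIsolated v

/-- The graph is the disjoint union of a nonempty set `I` of isolated vertices and of a nonempty
collection of half-graphs: the vertex sets of the half-graphs (the members of `P`) are pairwise
disjoint and disjoint from `I`, they cover all vertices outside `I`, each of them induces a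
half-graph, and no edge of the graph leaves any of them. -/
def IsDisjointUnionOfHalfGraphsAndIsolatedVertices (G : SimpleGraph V) : Prop :=
  ∃ (I : Set V) (P : Set (Set V)),
    I.Nonempty ∧ P.Nonempty ∧
    P.PairwiseDisjoint id ∧ (∀ W ∈ P, Disjoint I W) ∧ I ∪ ⋃₀ P = Set.univ ∧
    (∀ v ∈ I, G.IsIsolated v) ∧
    (∀ W ∈ P, (G.induce W).IsHalfGraph) ∧
    (∀ W ∈ P, ∀ v ∈ W, ∀ w, G.Adj v w → w ∈ W)

end SimpleGraph

open Relation

/-! Let M be the set of non-isolated vertices. Deleting a point that separates members of a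
connected family merges some pair of members, so a connected family separated by every point of M
has more than |M| members (`card_lt_ncard_of_connected`). There are at most |M| + 1 neighbourhoods,
so equality holds: some vertex is isolated, non-isolated vertices have distinct neighbourhoods, and
each x in M labels exactly one edge (`eq_of_insert_mem`). The upper end N(c x) of that edge lies in
every neighbourhood containing x, so in the inclusion order c x ≤ y iff x ~ y. Symmetry of ~ makes c
an antitone involution. Principal down-sets are chains, hence so are principal up-sets, and the
order splits into chains; each chain together with its c-image, a different chain, is a half-graph.
Conversely, in a union of half-graphs with an isolated vertex, one of any two distinct
neighbourhoods can lose a point outside the other, which gives geodesics by induction. -/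

/-! ### Counting members of connected set families -/

theorem exists_insert_mem_of_reflTransGen {X : Type u} {F : Set (Set X)} {A B : Set X} {x : X}
    (h : ReflTransGen (fun C D => C ∈ F ∧ D ∈ F ∧ (symmDiff C D).Subsingleton) A B)
    (hA : x ∉ A) (hB : x ∈ B) : ∃ C ∈ F, x ∉ C ∧ insert x C ∈ F := by
  induction h with
  | refl => exact absurd hB hA
  | @tail C D _ hCD ih =>
    by_cases hC : x ∈ C
    · exact ih hC
    · obtain ⟨hCF, hDF, hs⟩ := hCD
      refine ⟨C, hCF, hC, ?_⟩
      have : insert x C = D := by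
        ext y
        have hx : x ∈ symmDiff C D := Or.inr ⟨hB, hC⟩
        constructor
        · rintro (rfl | hy)
          · exact hB
          · by_contra hyD
            exact hC (hs hx (Or.inl ⟨hy, hyD⟩) ▸ hy)
        · intro hy
          by_contra hyC
          exact hyC (Or.inl (hs (Or.inr ⟨hy, fun h => hyC (Or.inr h)⟩) hx))
      rwa [this]

/-- Deleting `x` identifies `insert x C` with `C` for each `C ∈ E`, so the upper ends of these edges
contribute nothing new to the image. -/
theorem ncard_image_diff_singleton_add_le {X : Type u} [Finite X] {F E : Set (Set X)} {x : X}
    (hE : ∀ C ∈ E, x ∉ C ∧ C ∈ F ∧ insert x C ∈ F) :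
    ((fun A => A \ {x}) '' F).ncard + E.ncard ≤ F.ncard := by
  have hinj : Set.InjOn (fun C => insert x C) E := fun C hC D hD h => by
    have h' : insert x C = insert x D := h
    rw [← Set.insert_sdiff_self_of_notMem (hE C hC).1, h',
      Set.insert_sdiff_self_of_notMem (hE D hD).1]
  have hsub : (fun C => insert x C) '' E ⊆ F := by
    rintro _ ⟨C, hC, rfl⟩
    exact (hE C hC).2.2
  have himg : (fun A => A \ {x}) '' F ⊆
      (fun A => A \ {x}) '' (F \ (fun C => insert x C) '' E) := by
    rintro _ ⟨A, hA, rfl⟩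
    by_cases h : A ∈ (fun C => insert x C) '' E
    · obtain ⟨C, hC, rfl⟩ := h
      refine ⟨C, ⟨(hE C hC).2.1, ?_⟩, ?_⟩
      · rintro ⟨D, -, rfl⟩
        exact (hE _ hC).1 (Set.mem_insert x D)
      · simp
    · exact ⟨A, ⟨hA, h⟩, rfl⟩
  have h1 := (Set.ncard_le_ncard himg).trans (Set.ncard_image_le (Set.toFinite _))
  have h2 := Set.ncard_sdiff_add_ncard_of_subset hsub
  rw [hinj.ncard_image] at h2
  omega

/-- A step may collapse when `x` is deleted; this is why steps allow an empty symmetric difference.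
-/
theorem reflTransGen_image_diff_singleton {X : Type u} {F : Set (Set X)} (x : X)
    (hF : ∀ A ∈ F, ∀ B ∈ F,
      ReflTransGen (fun C D => C ∈ F ∧ D ∈ F ∧ (symmDiff C D).Subsingleton) A B) :
    ∀ A ∈ (fun A => A \ {x}) '' F, ∀ B ∈ (fun A => A \ {x}) '' F,
      ReflTransGen (fun C D => C ∈ (fun A => A \ {x}) '' F ∧ D ∈ (fun A => A \ {x}) '' F ∧
        (symmDiff C D).Subsingleton) A B := by
  rintro _ ⟨A, hA, rfl⟩ _ ⟨B, hB, rfl⟩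
  refine ReflTransGen.lift (fun A => A \ {x}) ?_ _ _ (hF A hA B hB)
  rintro C D ⟨hC, hD, hs⟩
  refine ⟨⟨C, hC, rfl⟩, ⟨D, hD, rfl⟩, hs.anti ?_⟩
  rintro y (⟨⟨h1, h2⟩, h3⟩ | ⟨⟨h1, h2⟩, h3⟩)
  · exact Or.inl ⟨h1, fun h => h3 ⟨h, h2⟩⟩
  · exact Or.inr ⟨h1, fun h => h3 ⟨h, h2⟩⟩

theorem card_lt_ncard_of_connected {X : Type u} [Finite X] (M : Finset X) {F : Set (Set X)}
    (hne : F.Nonempty)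
    (hF : ∀ A ∈ F, ∀ B ∈ F,
      ReflTransGen (fun C D => C ∈ F ∧ D ∈ F ∧ (symmDiff C D).Subsingleton) A B)
    (hM : ∀ x ∈ M, (∃ A ∈ F, x ∉ A) ∧ ∃ A ∈ F, x ∈ A) : M.card < F.ncard := by
  classical
  induction M using Finset.induction_on generalizing F with
  | empty => simpa using (Set.ncard_pos).2 hne
  | insert x M hx ih =>
    obtain ⟨⟨A, hA, hxA⟩, B, hB, hxB⟩ := hM x (Finset.mem_insert_self x M)
    obtain ⟨C, hC, hxC, hCx⟩ := exists_insert_mem_of_reflTransGen (hF A hA B hB) hxA hxB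
    have h1 := ncard_image_diff_singleton_add_le (F := F) (E := {C}) (x := x)
      (by rintro _ rfl; exact ⟨hxC, hC, hCx⟩)
    have h2 := ih (hne.image _) (reflTransGen_image_diff_singleton x hF) (fun y hy => by
      obtain ⟨⟨A, hA, hyA⟩, B, hB, hyB⟩ := hM y (Finset.mem_insert_of_mem hy)
      exact ⟨⟨_, ⟨A, hA, rfl⟩, fun h => hyA h.1⟩, _, ⟨B, hB, rfl⟩, hyB,
        fun h => hx (Set.mem_singleton_iff.1 h ▸ hy)⟩)
    rw [Finset.card_insert_of_notMem hx]
    rw [Set.ncard_singleton] at h1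
    omega

/-- If a connected family on `M` has at most one more member than `M` has points, then every point
of `M` is the label of only one edge. -/
theorem eq_of_insert_mem {X : Type u} [Finite X] {M : Finset X} {F : Set (Set X)}
    (hF : ∀ A ∈ F, ∀ B ∈ F,
      ReflTransGen (fun C D => C ∈ F ∧ D ∈ F ∧ (symmDiff C D).Subsingleton) A B)
    (hM : ∀ x ∈ M, (∃ A ∈ F, x ∉ A) ∧ ∃ A ∈ F, x ∈ A) (hcard : F.ncard ≤ M.card + 1)
    {x : X} (hx : x ∈ M) {C D : Set X} (hC : C ∈ F) (hxC : x ∉ C) (hCx : insert x C ∈ F)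
    (hD : D ∈ F) (hxD : x ∉ D) (hDx : insert x D ∈ F) : C = D := by
  classical
  by_contra hne
  -- Two edges labelled `x` would leave at most |M| - 1 members after deleting `x`, too few for the
  -- |M| - 1 remaining points.
  have h1 := ncard_image_diff_singleton_add_le (F := F) (E := {C, D}) (x := x)
    (by rintro _ (rfl | rfl); exacts [⟨hxC, hC, hCx⟩, ⟨hxD, hD, hDx⟩])
  have h2 := card_lt_ncard_of_connected (M.erase x) (Set.Nonempty.image _ ⟨C, hC⟩)
    (reflTransGen_image_diff_singleton x hF) (fun y hy => by
      obtain ⟨hyx, hy⟩ := Finset.mem_erase.1 hy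
      obtain ⟨⟨A, hA, hyA⟩, B, hB, hyB⟩ := hM y hy
      exact ⟨⟨_, ⟨A, hA, rfl⟩, fun h => hyA h.1⟩, _, ⟨B, hB, rfl⟩, hyB, hyx⟩)
  have h3 := Finset.card_erase_add_one hx
  rw [Set.ncard_pair hne] at h1
  omega

/-! ### Graph distance and symmetric difference -/

namespace SetSystem

variable {X : Type u} {F : SetSystem X}

theorem oneInclusionGraph_adj {A B : F.family} :
    F.oneInclusionGraph.Adj A B ↔ (∃ b, b ∉ (A : Set X) ∧ (B : Set X) = insert b (A : Set X)) ∨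
      ∃ a, a ∉ (B : Set X) ∧ (A : Set X) = insert a (B : Set X) := by
  simp only [oneInclusionGraph, Digraph.toSimpleGraphInclusive, SimpleGraph.fromRel_adj,
    oneInclusionDigraph, Set.union_singleton]
  refine ⟨fun h => h.2, fun h => ⟨?_, h⟩⟩
  rintro rfl
  rcases h with ⟨b, hb, h⟩ | ⟨b, hb, h⟩ <;> exact hb (h ▸ Set.mem_insert b _)

theorem symmDiff_insert_self {A : Set X} {b : X} (hb : b ∉ A) : symmDiff A (insert b A) = {b} := by
  ext y
  simp only [Set.mem_symmDiff, Set.mem_insert_iff, Set.mem_singleton_iff]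
  grind

theorem encard_symmDiff_of_adj {A B : F.family} (h : F.oneInclusionGraph.Adj A B) :
    (symmDiff (A : Set X) (B : Set X)).encard = 1 := by
  rcases oneInclusionGraph_adj.1 h with ⟨b, hb, h⟩ | ⟨b, hb, h⟩
  · rw [h, symmDiff_insert_self hb, Set.encard_singleton]
  · rw [h, symmDiff_comm, symmDiff_insert_self hb, Set.encard_singleton]

theorem encard_symmDiff_triangle (A B C : Set X) :
    (symmDiff A C).encard ≤ (symmDiff A B).encard + (symmDiff B C).encard :=
  (Set.encard_le_encard (symmDiff_triangle A B C)).trans (Set.encard_union_le _ _)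

theorem encard_symmDiff_le_length {A B : F.family} (p : F.oneInclusionGraph.Walk A B) :
    (symmDiff (A : Set X) (B : Set X)).encard ≤ p.length := by
  induction p with
  | nil => simp
  | @cons A B C h p ih =>
    refine (encard_symmDiff_triangle _ (B : Set X) _).trans ?_
    rw [encard_symmDiff_of_adj h, SimpleGraph.Walk.length_cons, Nat.cast_add, Nat.cast_one,
      add_comm]
    gcongr

theorem encard_symmDiff_le_edist (A B : F.family) :
    (symmDiff (A : Set X) (B : Set X)).encard ≤ F.oneInclusionGraph.edist A B := by
  rw [SimpleGraph.edist_eq_sInf]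
  refine le_sInf ?_
  rintro _ ⟨p, rfl⟩
  exact encard_symmDiff_le_length p

theorem symmDiff_eq_insert_symmDiff_diff_singleton {A B : Set X} {x : X} (hx : x ∈ B)
    (hxA : x ∉ A) :
    symmDiff A B = insert x (symmDiff A (B \ {x})) ∧ x ∉ symmDiff A (B \ {x}) := by
  constructor
  · ext y
    simp only [Set.mem_symmDiff, Set.mem_insert_iff, Set.mem_sdiff, Set.mem_singleton_iff]
    grind
  · simp [Set.mem_symmDiff, hxA]

theorem edist_le_of_exists_diff_singleton_mem [Finite X]
    (h : ∀ A ∈ F.family, ∀ B ∈ F.family, A ≠ B →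
      (∃ x ∈ B, x ∉ A ∧ B \ {x} ∈ F.family) ∨ ∃ x ∈ A, x ∉ B ∧ A \ {x} ∈ F.family) :
    ∀ (n : ℕ) (A B : F.family), (symmDiff (A : Set X) (B : Set X)).ncard = n →
      F.oneInclusionGraph.edist A B ≤ n := by
  intro n
  induction n with
  | zero =>
    intro A B hn
    rw [Set.ncard_eq_zero, Set.symmDiff_eq_empty] at hn
    simp [Subtype.ext hn]
  | succ n ih =>
    have key : ∀ A B : F.family, (symmDiff (A : Set X) (B : Set X)).ncard = n + 1 →
        (∃ x ∈ (B : Set X), x ∉ (A : Set X) ∧ (B : Set X) \ {x} ∈ F.family) →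
        F.oneInclusionGraph.edist A B ≤ (n + 1 : ℕ) := by
      rintro A B hn ⟨x, hxB, hxA, hB⟩
      obtain ⟨h1, h2⟩ := symmDiff_eq_insert_symmDiff_diff_singleton hxB hxA
      rw [h1, Set.ncard_insert_of_notMem h2, Nat.add_right_cancel_iff] at hn
      have hadj : F.oneInclusionGraph.Adj ⟨_, hB⟩ B := oneInclusionGraph_adj.2
        (Or.inl ⟨x, fun h => h.2 rfl, (Set.insert_sdiff_self_of_mem hxB).symm⟩)
      refine (SimpleGraph.edist_triangle (v := ⟨_, hB⟩)).trans ?_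
      rw [SimpleGraph.edist_eq_one_iff_adj.2 hadj, Nat.cast_add, Nat.cast_one]
      gcongr
      exact ih A ⟨_, hB⟩ hn
    intro A B hn
    have hne : (A : Set X) ≠ B := by
      intro hAB
      rw [hAB, symmDiff_self] at hn
      simp at hn
    rcases h A A.2 B B.2 hne with hx | hx
    · exact key A B hn hx
    · rw [SimpleGraph.edist_comm]
      exact key B A (by rwa [symmDiff_comm]) hx

theorem isWellGraded_of_exists_diff_singleton_mem [Finite X]
    (h : ∀ A ∈ F.family, ∀ B ∈ F.family, A ≠ B →
      (∃ x ∈ B, x ∉ A ∧ B \ {x} ∈ F.family) ∨ ∃ x ∈ A, x ∉ B ∧ A \ {x} ∈ F.family) :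
    F.IsWellGraded := fun A B => by
  refine le_antisymm (encard_symmDiff_le_edist A B) ?_
  rw [← Set.Finite.cast_ncard_eq (Set.toFinite _)]
  exact edist_le_of_exists_diff_singleton_mem h _ A B rfl

theorem IsWellGraded.reachable [Finite X] (hF : F.IsWellGraded) (A B : F.family) :
    F.oneInclusionGraph.Reachable A B := by
  rw [← SimpleGraph.edist_ne_top_iff_reachable, ← hF A B]
  exact Set.encard_ne_top_iff.2 (Set.toFinite _)

theorem IsWellGraded.reflTransGen [Finite X] (hF : F.IsWellGraded) :
    ∀ A ∈ F.family, ∀ B ∈ F.family, ReflTransGen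
      (fun C D => C ∈ F.family ∧ D ∈ F.family ∧ (symmDiff C D).Subsingleton) A B := by
  intro A hA B hB
  obtain ⟨p⟩ := hF.reachable ⟨A, hA⟩ ⟨B, hB⟩
  suffices h : ∀ A B : F.family, F.oneInclusionGraph.Walk A B → ReflTransGen
      (fun C D => C ∈ F.family ∧ D ∈ F.family ∧ (symmDiff C D).Subsingleton) (A : Set X) B from
    h _ _ p
  intro A B p
  induction p with
  | nil => exact ReflTransGen.refl
  | @cons A B C h p ih =>
    refine ReflTransGen.head ⟨A.2, B.2, ?_⟩ ih
    exact Set.encard_le_one_iff_subsingleton.1 (encard_symmDiff_of_adj h).le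

/-- A geodesic from `A` to `∅` has length |A|; its first edge cannot add a point, since |A| - 1
further steps cannot empty a set of size |A| + 1. -/
theorem IsWellGraded.exists_diff_singleton_mem [Finite X] (hF : F.IsWellGraded)
    (h0 : ∅ ∈ F.family) {A : Set X} (hA : A ∈ F.family) (hne : A.Nonempty) :
    ∃ b ∈ A, A \ {b} ∈ F.family := by
  have hd := hF ⟨A, hA⟩ ⟨∅, h0⟩
  obtain ⟨p, hp⟩ := (hF.reachable ⟨A, hA⟩ ⟨∅, h0⟩).exists_walk_length_eq_edist
  rw [← hd] at hp
  cases p with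
  | nil => exact absurd hne (by simp)
  | @cons _ C _ h p =>
    have h1 := encard_symmDiff_le_length p
    have hbot : ∀ D : Set X, symmDiff D ∅ = D := fun D => symmDiff_bot D
    simp only [hbot] at hp h1
    rcases oneInclusionGraph_adj.1 h with ⟨b, hb, hC⟩ | ⟨b, hb, hC⟩
    · rw [hC, Set.encard_insert_of_notMem hb, ← hp, SimpleGraph.Walk.length_cons] at h1
      norm_cast at h1
      omega
    · simp only at hC
      refine ⟨b, hC ▸ Set.mem_insert b _, ?_⟩
      rw [hC, Set.insert_sdiff_self_of_notMem hb]
      exact C.2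

end SetSystem

/-! ### Unions of half-graphs are well-graded -/

namespace SimpleGraph

variable {V : Type u}

/-- Every neighbourhood has a point whose removal leaves a neighbourhood or the empty set and which
belongs only to larger neighbourhoods. -/
def HasRemovablePoints {W : Type*} (H : SimpleGraph W) : Prop :=
  ∀ y, ∃ b, H.Adj y b ∧ (∀ z w, H.Adj b z → H.Adj y w → H.Adj z w) ∧
    ((∀ w, H.Adj y w → w = b) ∨ ∃ z, ∀ w, H.Adj z w ↔ H.Adj y w ∧ w ≠ b)

theorem hasRemovablePoints_bipartiteOfRel_le (n : ℕ) :
    (bipartiteOfRel n fun i j => i ≤ j).HasRemovablePoints := by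
  rintro (i | j)
  -- N(a_i) without b_i is N(a_{i+1}), or empty for the last i; dually, N(b_j) without a_j is
  -- N(b_{j-1}).
  · refine ⟨Sum.inr i, le_refl i, ?_, ?_⟩
    · rintro (k | k) (l | l) h1 h2
      · exact h2
      · exact le_trans (show k ≤ i from h1) (show i ≤ l from h2)
      · exact h1.elim
      · exact h1.elim
    · by_cases hi : (i : ℕ) + 1 < n
      · refine Or.inr ⟨Sum.inl ⟨i + 1, hi⟩, ?_⟩
        rintro (l | l)
        · exact ⟨False.elim, fun h => h.1⟩
        · change (⟨i + 1, hi⟩ : Fin n) ≤ l ↔ i ≤ l ∧ _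
          simp only [Fin.le_def, ne_eq, Sum.inr.injEq, Fin.ext_iff]
          omega
      · refine Or.inl ?_
        rintro (l | l) h
        · exact h.elim
        · have h' : (i : ℕ) ≤ l := h
          rw [Sum.inr.injEq, Fin.ext_iff]
          omega
  · refine ⟨Sum.inl j, le_refl j, ?_, ?_⟩
    · rintro (k | k) (l | l) h1 h2
      · exact h1.elim
      · exact h1.elim
      · exact le_trans (show l ≤ j from h2) (show j ≤ k from h1)
      · exact h2
    · by_cases hj : 0 < (j : ℕ)
      · refine Or.inr ⟨Sum.inr ⟨j - 1, by omega⟩, ?_⟩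
        rintro (l | l)
        · change l ≤ (⟨j - 1, _⟩ : Fin n) ↔ l ≤ j ∧ _
          simp only [Fin.le_def, ne_eq, Sum.inl.injEq, Fin.ext_iff]
          omega
        · exact ⟨False.elim, fun h => h.1⟩
      · refine Or.inl ?_
        rintro (l | l) h
        · have h' : (l : ℕ) ≤ j := h
          rw [Sum.inl.injEq, Fin.ext_iff]
          omega
        · exact h.elim

/-- Exchanging the two parts of a bipartite graph transposes the relation. -/
def bipartiteOfRelComm (n : ℕ) (r : Fin n → Fin n → Prop) :
    bipartiteOfRel n r ≃g bipartiteOfRel n fun i j => r j i where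
  toEquiv := Equiv.sumComm _ _
  map_rel_iff' := by rintro (i | i) (j | j) <;> exact Iff.rfl

theorem HasRemovablePoints.of_iso {W W' : Type*} {H : SimpleGraph W} {H' : SimpleGraph W'}
    (h : H'.HasRemovablePoints) (e : H ≃g H') : H.HasRemovablePoints := by
  intro y
  obtain ⟨b, h1, h2, h3⟩ := h (e y)
  have hb : e (e.symm b) = b := e.apply_symm_apply b
  refine ⟨e.symm b, ?_, fun z w => ?_, h3.imp (fun h w hw => ?_) ?_⟩
  · rwa [← e.map_adj_iff, hb]
  · rw [← e.map_adj_iff, ← e.map_adj_iff (v := y), ← e.map_adj_iff (v := z), hb]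
    exact h2 _ _
  · rw [← h (e w) (e.map_adj_iff.2 hw), e.symm_apply_apply]
  · rintro ⟨z, hz⟩
    refine ⟨e.symm z, fun w => ?_⟩
    rw [← e.map_adj_iff, ← e.map_adj_iff (v := y), e.apply_symm_apply, hz, ne_eq, ne_eq,
      RelIso.eq_symm_apply]

theorem IsHalfGraph.hasRemovablePoints {W : Type u} {H : SimpleGraph W} (h : H.IsHalfGraph) :
    H.HasRemovablePoints := by
  obtain ⟨n, -, h⟩ := h
  rcases h with ⟨⟨e⟩⟩ | ⟨⟨e⟩⟩
  · exact (hasRemovablePoints_bipartiteOfRel_le n).of_iso e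
  · exact (hasRemovablePoints_bipartiteOfRel_le n).of_iso (e.trans (bipartiteOfRelComm n _))

theorem isNeighbourhoodWellGraded_of_removable [Finite V] [Nonempty V] {G : SimpleGraph V}
    (h : ∀ y, ¬ G.IsIsolated y → ∃ b ∈ G.neighborSet y,
      (∀ z, b ∈ G.neighborSet z → G.neighborSet y ⊆ G.neighborSet z) ∧
      G.neighborSet y \ {b} ∈ Set.range G.neighborSet) :
    G.IsNeighbourhoodWellGraded := by
  apply SetSystem.isWellGraded_of_exists_diff_singleton_mem
  have key : ∀ y z, ¬ G.neighborSet y ⊆ G.neighborSet z →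
      ∃ x ∈ G.neighborSet y, x ∉ G.neighborSet z ∧
        G.neighborSet y \ {x} ∈ Set.range G.neighborSet := by
    intro y z hyz
    have hy : ¬ G.IsIsolated y := fun hy => hyz (by simp [hy])
    obtain ⟨b, hb, h1, h2⟩ := h y hy
    exact ⟨b, hb, fun hbz => hyz (h1 z hbz), h2⟩
  rintro _ ⟨y, rfl⟩ _ ⟨z, rfl⟩ hne
  by_cases hyz : G.neighborSet y ⊆ G.neighborSet z
  · exact Or.inl (key z y fun hzy => hne (hyz.antisymm hzy))
  · exact Or.inr (key y z hyz)

theorem IsDisjointUnionOfHalfGraphsAndIsolatedVertices.isNeighbourhoodWellGraded [Finite V]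
    [Nonempty V] {G : SimpleGraph V} (h : G.IsDisjointUnionOfHalfGraphsAndIsolatedVertices) :
    G.IsNeighbourhoodWellGraded := by
  obtain ⟨I, P, ⟨v₀, hv₀⟩, -, -, -, hcover, hI, hhalf, hclosed⟩ := h
  refine isNeighbourhoodWellGraded_of_removable fun y hy => ?_
  obtain hyI | ⟨W, hW, hyW⟩ : y ∈ I ∪ ⋃₀ P := hcover ▸ Set.mem_univ y
  · exact absurd (hI y hyI) hy
  have hcl := hclosed W hW
  obtain ⟨⟨b, hbW⟩, hyb, h1, h2⟩ := (hhalf W hW).hasRemovablePoints ⟨y, hyW⟩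
  refine ⟨b, hyb, fun z hz w hw => ?_, ?_⟩
  · exact h1 ⟨z, hcl b hbW z hz.symm⟩ ⟨w, hcl y hyW w hw⟩ (G.adj_symm hz) hw
  · rcases h2 with h2 | ⟨⟨z, hzW⟩, h2⟩
    -- Here N(y) = {b}; the isolated vertex supplies the empty neighbourhood.
    · refine ⟨v₀, ?_⟩
      rw [(hI v₀ hv₀).neighborSet_eq_empty, eq_comm, Set.sdiff_eq_empty]
      intro w hw
      exact congrArg Subtype.val (h2 ⟨w, hcl y hyW w hw⟩ hw)
    · refine ⟨z, Set.ext fun w => ⟨fun hw => ?_, fun hw => ?_⟩⟩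
      · obtain ⟨h3, h4⟩ := (h2 ⟨w, hcl z hzW w hw⟩).1 hw
        exact ⟨h3, fun h => h4 (Subtype.ext h)⟩
      · exact (h2 ⟨w, hcl y hyW w hw.1⟩).2 ⟨hw.1, fun h => hw.2 (congrArg Subtype.val h)⟩

theorem IsNonemptySetOfIsolatedVertices.isNeighbourhoodWellGraded [Finite V]
    [Nonempty V] {G : SimpleGraph V} (h : G.IsNonemptySetOfIsolatedVertices) :
    G.IsNeighbourhoodWellGraded :=
  isNeighbourhoodWellGraded_of_removable fun y hy => absurd (h.2 y) hy

end SimpleGraph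

/-! ### Dualities of forest orders -/

/-- An antitone involution of a finite forest order, given by its symmetric relation
`c x ≤ y`, assumed irreflexive. -/
structure ForestDuality (W : Type*) [PartialOrder W] where
  /-- The involution. -/
  c : W → W
  surjective : Function.Surjective c
  comm : ∀ {x y}, c x ≤ y → c y ≤ x
  irrefl : ∀ x, ¬ c x ≤ x
  chain : ∀ {x y z : W}, y ≤ x → z ≤ x → y ≤ z ∨ z ≤ y

namespace ForestDuality

variable {W : Type*} [PartialOrder W] (d : ForestDuality W)

theorem antitone {p q : W} (h : p ≤ q) : d.c q ≤ d.c p :=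
  d.comm ((d.comm le_rfl).trans h)

theorem involutive (x : W) : d.c (d.c x) = x := by
  have h : ∀ x, d.c (d.c x) ≤ x := fun x => d.comm le_rfl
  obtain ⟨y, rfl⟩ := d.surjective x
  exact (h _).antisymm (d.antitone (h y))

theorem le_iff {p q : W} : d.c q ≤ d.c p ↔ p ≤ q :=
  ⟨fun h => by simpa only [d.involutive] using d.antitone h, d.antitone⟩

/-- Comparability. -/
def Comp (p q : W) : Prop := p ≤ q ∨ q ≤ p

theorem Comp.symm {p q : W} (h : Comp p q) : Comp q p := Or.symm h

/-- Two elements with a common upper bound are comparable by `chain`; a common lower bound becomes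
an upper bound under `c`. -/
theorem comp_trans (d : ForestDuality W) {p q r : W} (h1 : Comp p q) (h2 : Comp q r) : Comp p r := by
  rcases h1 with h1 | h1 <;> rcases h2 with h2 | h2
  · exact Or.inl (h1.trans h2)
  · exact d.chain h1 h2
  · exact (d.chain (d.antitone h1) (d.antitone h2)).symm.imp d.le_iff.1 d.le_iff.1
  · exact Or.inr (h2.trans h1)

theorem comp_map {p q : W} (h : Comp p q) : Comp (d.c p) (d.c q) :=
  h.symm.imp d.antitone d.antitone

theorem not_comp_self [Finite W] (x : W) : ¬ Comp x (d.c x) := by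
  rintro (h | h)
  -- A maximal `y` above `x` would satisfy `c y ≤ c x ≤ y`.
  · obtain ⟨y, hxy, hy⟩ := Finite.exists_le_maximal (p := fun _ : W => True) (a := x) trivial
    have h1 : d.c x ≤ y := (d.comp_trans (Or.inr hxy) (Or.inl h)).elim (hy.2 trivial) id
    exact d.irrefl y ((d.antitone hxy).trans h1)
  · exact d.irrefl x h

/-- Comparability with `x` or with its image. -/
def Linked (x y : W) : Prop := Comp x y ∨ Comp (d.c x) y

theorem linked_refl (x : W) : d.Linked x x := Or.inl (Or.inl le_rfl)

theorem Linked.symm {d : ForestDuality W} {x y : W} (h : d.Linked x y) : d.Linked y x :=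
  h.imp Comp.symm fun h => by simpa only [d.involutive] using (d.comp_map h).symm

theorem Linked.trans {d : ForestDuality W} {x y z : W} (h1 : d.Linked x y) (h2 : d.Linked y z) :
    d.Linked x z := by
  rcases h1 with h1 | h1 <;> rcases h2 with h2 | h2
  · exact Or.inl (d.comp_trans h1 h2)
  · exact Or.inr (d.comp_trans (d.comp_map h1) h2)
  · exact Or.inr (d.comp_trans h1 h2)
  · refine Or.inl (d.comp_trans ?_ h2)
    simpa only [d.involutive] using d.comp_map h1

/-- The chain through `x` is order isomorphic to some `Fin n`. -/
theorem exists_enumeration [Finite W] (d : ForestDuality W) (x : W) : ∃ n, 1 ≤ n ∧ ∃ e : Fin n → W,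
    (∀ i j, e i ≤ e j ↔ i ≤ j) ∧ Set.range e = {y | Comp x y} := by
  classical
  have := Fintype.ofFinite W
  let L : LinearOrder {y // Comp x y} :=
    { (inferInstance : PartialOrder {y // Comp x y}) with
      le_total := fun a b => d.comp_trans a.2.symm b.2
      toDecidableLE := Classical.decRel _ }
  let e := Fintype.orderIsoFinOfCardEq {y // Comp x y} rfl
  refine ⟨_, Fintype.card_pos_iff.2 ⟨⟨x, Or.inl le_rfl⟩⟩, fun i => (e i).1,
    fun i j => e.le_iff_le, ?_⟩
  ext y
  exact ⟨by rintro ⟨i, rfl⟩; exact (e i).2, fun hy => ⟨e.symm ⟨y, hy⟩, by simp⟩⟩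

end ForestDuality

/-! ### Half-graphs from a duality -/

namespace SimpleGraph

variable {V : Type u}

theorem isHalfGraph_induce_range {G : SimpleGraph V} {n : ℕ} (hn : 1 ≤ n)
    {f : Fin n ⊕ Fin n → V} (hf : Function.Injective f)
    (h : ∀ p q, G.Adj (f p) (f q) ↔ (bipartiteOfRel n fun i j => i ≥ j).Adj p q) :
    (G.induce (Set.range f)).IsHalfGraph := by
  let e : bipartiteOfRel n (fun i j => i ≥ j) ≃g G.induce (Set.range f) :=
    ⟨Equiv.ofInjective f hf, fun {p q} => h p q⟩
  exact ⟨n, hn, Or.inr ⟨e.symm⟩⟩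

/-- The non-isolated vertices, ordered by inclusion of neighbourhoods. -/
abbrev neighbourhoodOrder (G : SimpleGraph V)
    (hinj : Set.InjOn G.neighborSet {v | ¬ G.IsIsolated v}) :
    PartialOrder {v // ¬ G.IsIsolated v} :=
  PartialOrder.lift (fun v => G.neighborSet v) fun v w h => Subtype.ext (hinj v.2 w.2 h)

/-- The chain through `x` gives the a_i and its image under `c` the b_j. `not_comp_self` makes the
two parts disjoint and free of inner edges. -/
theorem isHalfGraph_induce_linked [Finite V] {G : SimpleGraph V}
    [PartialOrder {v // ¬ G.IsIsolated v}] (d : ForestDuality {v // ¬ G.IsIsolated v})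
    (hd : ∀ x y, d.c x ≤ y ↔ G.Adj (x : V) y) (x : {v // ¬ G.IsIsolated v}) :
    (G.induce (Subtype.val '' {y | d.Linked x y})).IsHalfGraph := by
  obtain ⟨n, hn, e, he, hrange⟩ := d.exists_enumeration x
  have hex : ∀ i, ForestDuality.Comp x (e i) := fun i => by
    have : e i ∈ Set.range e := ⟨i, rfl⟩
    rwa [hrange] at this
  have hcomp : ∀ i j, ForestDuality.Comp (e i) (e j) := fun i j =>
    d.comp_trans (hex i).symm (hex j)
  have hinj : Function.Injective e := fun i j h =>
    le_antisymm ((he i j).1 h.le) ((he j i).1 h.ge)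
  have hne : ∀ i j, ¬ ForestDuality.Comp (e i) (d.c (e j)) := fun i j h =>
    d.not_comp_self (e j) (d.comp_trans (hcomp j i) h)
  let f : Fin n ⊕ Fin n → V := Sum.elim (fun i => (e i).1) fun j => (d.c (e j)).1
  have hf : Function.Injective f := by
    rintro (i | i) (j | j) h
    · exact congrArg _ (hinj (Subtype.ext h))
    · exact (hne i j (Or.inl (Subtype.ext h).le)).elim
    · exact (hne j i (Or.inl (Subtype.ext h.symm).le)).elim
    · have h' : d.c (e i) = d.c (e j) := Subtype.ext h
      exact congrArg _ (hinj (by rw [← d.involutive (e i), h', d.involutive]))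
  have hS : Subtype.val '' {y | d.Linked x y} = Set.range f := by
    ext v
    constructor
    · rintro ⟨y, hy | hy, rfl⟩
      · have : y ∈ Set.range e := hrange ▸ hy
        obtain ⟨i, rfl⟩ := this
        exact ⟨Sum.inl i, rfl⟩
      · have : d.c y ∈ Set.range e := hrange ▸ (by
          simpa only [d.involutive] using d.comp_map hy : ForestDuality.Comp x (d.c y))
        obtain ⟨i, hi⟩ := this
        exact ⟨Sum.inr i, by simp [f, hi, d.involutive]⟩
    · rintro ⟨i | i, rfl⟩
      · exact ⟨e i, Or.inl (hex i), rfl⟩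
      · exact ⟨d.c (e i), Or.inr (d.comp_map (hex i)), rfl⟩
  rw [hS]
  refine isHalfGraph_induce_range hn hf ?_
  have hab : ∀ i j, G.Adj (e i).1 (d.c (e j)).1 ↔ j ≤ i := fun i j => by
    rw [← hd, d.le_iff, he]
  rintro (i | i) (j | j)
  · refine ⟨fun h => ?_, False.elim⟩
    exact hne j i (Or.inr ((hd _ _).2 h))
  · exact hab i j
  · exact (G.adj_comm _ _).trans (hab j i)
  · refine ⟨fun h => ?_, False.elim⟩
    have := (hd _ _).2 h
    rw [d.involutive] at this
    exact hne i j (Or.inl this)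

theorem isDisjointUnion_of_forestDuality [Finite V] {G : SimpleGraph V}
    [PartialOrder {v // ¬ G.IsIsolated v}] (d : ForestDuality {v // ¬ G.IsIsolated v})
    (hd : ∀ x y, d.c x ≤ y ↔ G.Adj (x : V) y) (h0 : ∃ v, G.IsIsolated v)
    (h1 : ∃ v, ¬ G.IsIsolated v) : G.IsDisjointUnionOfHalfGraphsAndIsolatedVertices := by
  refine ⟨{v | G.IsIsolated v}, Set.range fun x => Subtype.val '' {y | d.Linked x y}, h0, ?_,
    ?_, ?_, ?_, fun _ h => h, ?_, ?_⟩
  · obtain ⟨v, hv⟩ := h1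
    exact ⟨_, ⟨v, hv⟩, rfl⟩
  · rintro _ ⟨x, rfl⟩ _ ⟨y, rfl⟩ hne
    rw [Function.onFun, id, id, Set.disjoint_left]
    rintro _ ⟨z, hxz, rfl⟩ ⟨z', hyz, hz⟩
    obtain rfl := Subtype.ext hz
    have hxy : d.Linked x y := ForestDuality.Linked.trans hxz (ForestDuality.Linked.symm hyz)
    refine hne (congrArg _ (Set.ext fun w => ⟨fun h => ?_, fun h => ?_⟩))
    · exact ForestDuality.Linked.trans hxy.symm h
    · exact ForestDuality.Linked.trans hxy h
  · rintro _ ⟨x, rfl⟩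
    rw [Set.disjoint_left]
    rintro _ hv ⟨y, -, rfl⟩
    exact y.2 hv
  · rw [Set.eq_univ_iff_forall]
    intro v
    by_cases hv : G.IsIsolated v
    · exact Or.inl hv
    · exact Or.inr ⟨_, ⟨⟨v, hv⟩, rfl⟩, ⟨v, hv⟩, d.linked_refl _, rfl⟩
  · rintro _ ⟨x, rfl⟩
    exact isHalfGraph_induce_linked d hd x
  · rintro _ ⟨x, rfl⟩ _ ⟨y, hxy, rfl⟩ w hw
    refine ⟨⟨w, hw.not_isIsolated_right⟩, ?_, rfl⟩
    exact ForestDuality.Linked.trans hxy (Or.inr (Or.inl ((hd _ _).2 hw)))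

end SimpleGraph

/-! ### The duality of a well-graded neighbourhood system -/

namespace SimpleGraph

variable {V : Type u} {G : SimpleGraph V}

theorem exists_notMem_and_exists_mem_neighborSet [Nonempty V] {x : V} (hx : ¬ G.IsIsolated x) :
    (∃ A ∈ G.neighbourhoodSystem.family, x ∉ A) ∧ ∃ A ∈ G.neighbourhoodSystem.family, x ∈ A := by
  obtain ⟨y, hy⟩ := exists_adj_iff_not_isIsolated.2 hx
  exact ⟨⟨_, ⟨x, rfl⟩, G.loopless.irrefl x⟩, _, ⟨y, rfl⟩, hy.symm⟩

theorem range_neighborSet_subset :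
    Set.range G.neighborSet ⊆ insert ∅ (G.neighborSet '' {v | ¬ G.IsIsolated v}) := by
  rintro _ ⟨v, rfl⟩
  by_cases hv : G.IsIsolated v
  · exact Or.inl hv.neighborSet_eq_empty
  · exact Or.inr ⟨v, hv, rfl⟩

theorem ncard_range_neighborSet_le [Finite V] :
    (Set.range G.neighborSet).ncard ≤ {v | ¬ G.IsIsolated v}.ncard + 1 :=
  (Set.ncard_le_ncard range_neighborSet_subset).trans <| (Set.ncard_insert_le _ _).trans <|
    Nat.add_le_add_right (Set.ncard_image_le (Set.toFinite _)) 1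

namespace IsNeighbourhoodWellGraded

variable [Finite V] [Nonempty V]

theorem ncard_lt (hG : G.IsNeighbourhoodWellGraded) :
    {v | ¬ G.IsIsolated v}.ncard < (Set.range G.neighborSet).ncard := by
  rw [Set.ncard_eq_toFinset_card _ (Set.toFinite _)]
  exact card_lt_ncard_of_connected _ G.neighbourhoodSystem.nonempty
    (SetSystem.IsWellGraded.reflTransGen hG) fun x hx =>
      exists_notMem_and_exists_mem_neighborSet (by simpa using hx)

theorem exists_isIsolated (hG : G.IsNeighbourhoodWellGraded) : ∃ v, G.IsIsolated v := by
  by_contra! h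
  have h1 := hG.ncard_lt
  rw [← Set.image_univ, (Set.eq_univ_iff_forall.2 h : {v | ¬ G.IsIsolated v} = Set.univ)] at h1
  exact h1.not_ge (Set.ncard_image_le (Set.toFinite _))

theorem injOn (hG : G.IsNeighbourhoodWellGraded) :
    Set.InjOn G.neighborSet {v | ¬ G.IsIsolated v} := by
  refine Set.injOn_of_ncard_image_eq ?_ (Set.toFinite _)
  refine le_antisymm (Set.ncard_image_le (Set.toFinite _)) ?_
  have h1 := hG.ncard_lt
  have h2 := (Set.ncard_le_ncard (range_neighborSet_subset (G := G))).trans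
    (Set.ncard_insert_le _ _)
  omega

theorem eq_of_insert_mem (hG : G.IsNeighbourhoodWellGraded) {x : V} {C D : Set V}
    (hC : C ∈ Set.range G.neighborSet) (hxC : x ∉ C) (hCx : insert x C ∈ Set.range G.neighborSet)
    (hD : D ∈ Set.range G.neighborSet) (hxD : x ∉ D)
    (hDx : insert x D ∈ Set.range G.neighborSet) : C = D := by
  have hx : ¬ G.IsIsolated x := by
    obtain ⟨y, hy⟩ := hCx
    have : x ∈ G.neighborSet y := hy ▸ Set.mem_insert x C
    exact Adj.not_isIsolated_right this
  refine _root_.eq_of_insert_mem (M := (Set.toFinite {v | ¬ G.IsIsolated v}).toFinset)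
    (SetSystem.IsWellGraded.reflTransGen hG)
    (fun x hx => exists_notMem_and_exists_mem_neighborSet (by simpa using hx)) ?_
    (by simpa using hx) hC hxC hCx hD hxD hDx
  rw [← Set.ncard_eq_toFinset_card]
  exact ncard_range_neighborSet_le

theorem exists_diff_singleton_mem (hG : G.IsNeighbourhoodWellGraded) {A : Set V}
    (hA : A ∈ Set.range G.neighborSet) (hne : A.Nonempty) :
    ∃ b ∈ A, A \ {b} ∈ Set.range G.neighborSet := by
  obtain ⟨v, hv⟩ := hG.exists_isIsolated
  exact SetSystem.IsWellGraded.exists_diff_singleton_mem hG ⟨v, hv.neighborSet_eq_empty⟩ hA hne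

/-- The neighbourhood that is the upper end of an edge labelled `b` is contained in every
neighbourhood that contains `b`. -/
theorem subset_of_mem (hG : G.IsNeighbourhoodWellGraded) {A B : Set V} {b : V}
    (hA : A ∈ Set.range G.neighborSet) (hbA : b ∈ A) (hAb : A \ {b} ∈ Set.range G.neighborSet)
    (hB : B ∈ Set.range G.neighborSet) (hbB : b ∈ B) : A ⊆ B := by
  -- By minimality, the only point removable from `D` is `b`, so `D` is also the upper end of an
  -- edge labelled `b`, and uniqueness gives `D = A`.
  obtain ⟨D, hDB, hD⟩ := (Set.toFinite {D | D ∈ Set.range G.neighborSet ∧ b ∈ D}).exists_le_minimal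
    (a := B) ⟨hB, hbB⟩
  obtain ⟨x, hx, hDx⟩ := hG.exists_diff_singleton_mem hD.1.1 ⟨b, hD.1.2⟩
  have hxb : x = b := by
    by_contra hne
    exact (hD.2 ⟨hDx, hD.1.2, fun h => hne h.symm⟩ Set.sdiff_subset hx).2 rfl
  subst hxb
  have h := hG.eq_of_insert_mem hAb (fun h => h.2 rfl)
    (by rwa [Set.insert_sdiff_self_of_mem hbA]) hDx (fun h => h.2 rfl)
    (by rw [Set.insert_sdiff_self_of_mem hx]; exact hD.1.1)
  rw [← Set.insert_sdiff_self_of_mem hbA, h, Set.insert_sdiff_self_of_mem hx]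
  exact hDB

theorem exists_upper_end (hG : G.IsNeighbourhoodWellGraded) {x : V} (hx : ¬ G.IsIsolated x) :
    ∃ y, ¬ G.IsIsolated y ∧ x ∈ G.neighborSet y ∧
      G.neighborSet y \ {x} ∈ Set.range G.neighborSet := by
  obtain ⟨⟨A, hA, hxA⟩, B, hB, hxB⟩ := exists_notMem_and_exists_mem_neighborSet hx
  obtain ⟨C, hC, hxC, y, hy⟩ := exists_insert_mem_of_reflTransGen
    (SetSystem.IsWellGraded.reflTransGen hG A hA B hB) hxA hxB
  have hxy : x ∈ G.neighborSet y := hy ▸ Set.mem_insert x C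
  refine ⟨y, Adj.not_isIsolated_left hxy, hxy, ?_⟩
  rw [hy, Set.insert_sdiff_self_of_notMem hxC]
  exact hC

/-- Remove a removable point `b` from `D`: a subset of `D` in the family that contains `b` is all of
`D`, and otherwise both sets lie in `D \ {b}`. -/
theorem subset_or_subset (hG : G.IsNeighbourhoodWellGraded) : ∀ (n : ℕ) (A B D : Set V),
    A ∈ Set.range G.neighborSet → B ∈ Set.range G.neighborSet → D ∈ Set.range G.neighborSet →
    D.ncard = n → A ⊆ D → B ⊆ D → A ⊆ B ∨ B ⊆ A := by
  intro n
  induction n with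
  | zero =>
    intro A B D _ _ _ hn hAD _
    rw [Set.ncard_eq_zero] at hn
    exact Or.inl (hAD.trans (hn ▸ Set.empty_subset B))
  | succ n ih =>
    intro A B D hA hB hD hn hAD hBD
    obtain ⟨b, hb, hDb⟩ := hG.exists_diff_singleton_mem hD
      (Set.nonempty_of_ncard_ne_zero (by omega))
    by_cases hbA : b ∈ A
    · exact Or.inr (hBD.trans (hG.subset_of_mem hD hb hDb hA hbA))
    by_cases hbB : b ∈ B
    · exact Or.inl (hAD.trans (hG.subset_of_mem hD hb hDb hB hbB))
    refine ih A B _ hA hB hDb ?_ (Set.subset_sdiff_singleton hAD hbA)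
      (Set.subset_sdiff_singleton hBD hbB)
    rw [Set.ncard_sdiff_singleton_of_mem hb, hn, Nat.add_sub_cancel]

theorem isDisjointUnion (hG : G.IsNeighbourhoodWellGraded) (h1 : ∃ v, ¬ G.IsIsolated v) :
    G.IsDisjointUnionOfHalfGraphsAndIsolatedVertices := by
  let _ := G.neighbourhoodOrder hG.injOn
  choose c hc hcx hcd using fun x : {v // ¬ G.IsIsolated v} => hG.exists_upper_end x.2
  have hle : ∀ x y : {v // ¬ G.IsIsolated v},
      (⟨c x, hc x⟩ : {v // ¬ G.IsIsolated v}) ≤ y ↔ G.Adj (x : V) y := fun x y =>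
    ⟨fun h => (h (hcx x) : G.Adj y x).symm,
      fun h => hG.subset_of_mem ⟨_, rfl⟩ (hcx x) (hcd x) ⟨_, rfl⟩ h.symm⟩
  let d : ForestDuality {v // ¬ G.IsIsolated v} :=
    { c := fun x => ⟨c x, hc x⟩
      -- If `b` is removable from N(y), then N(y) is the upper end of the edge labelled `b`, so `y`
      -- is the image of `b`.
      surjective := fun y => by
        obtain ⟨b, hb, hyb⟩ := hG.exists_diff_singleton_mem ⟨y, rfl⟩ ((neighborSet_nonempty G).2 y.2)
        refine ⟨⟨b, Adj.not_isIsolated_right hb⟩, le_antisymm ((hle _ _).2 (G.adj_symm hb)) ?_⟩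
        exact hG.subset_of_mem ⟨_, rfl⟩ hb hyb ⟨_, rfl⟩ (hcx _)
      comm := fun h => (hle _ _).2 ((hle _ _).1 h).symm
      irrefl := fun x h => G.loopless.irrefl _ ((hle _ _).1 h)
      chain := fun h2 h3 => hG.subset_or_subset _ _ _ _ ⟨_, rfl⟩ ⟨_, rfl⟩ ⟨_, rfl⟩ rfl h2 h3 }
  exact isDisjointUnion_of_forestDuality d hle hG.exists_isIsolated h1

end IsNeighbourhoodWellGraded

end SimpleGraph

theorem mainTheorem2 {V : Type u} [Finite V] [Nonempty V] (G : SimpleGraph V) :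
    G.IsNeighbourhoodWellGraded ↔
      G.IsNonemptySetOfIsolatedVertices ∨ G.IsDisjointUnionOfHalfGraphsAndIsolatedVertices := by
  constructor
  · intro hG
    by_cases h : ∀ v, G.IsIsolated v
    · exact Or.inl ⟨inferInstance, h⟩
    · exact Or.inr (hG.isDisjointUnion (not_forall.1 h))
  · rintro (h | h)
    · exact h.isNeighbourhoodWellGraded
    · exact h.isNeighbourhoodWellGraded
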